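/- Let $\mathcal H_A,\mathcal H_B$ be finite-dimensional complex Hilbert spaces and $\mathcal H_{AB}=\mathcal H_A\otimes\mathcal H_B$; $\log$ is the logarithm to base $2$. Write $S_=(\mathcal H)$ for the positive semi-definite operators on $\mathcal H$ of trace $1$ and $S_\le(\mathcal H)$ for those with trace in $(0,1]$. For $\rho,\sigma\in S_\le(\mathcal H)$ put $F(\rho,\sigma)=\|\sqrt\rho\sqrt\sigma\|_1+\sqrt{(1-\operatorname{tr}\rho)(1-\operatorname{tr}\sigma)}$, where $\|O\|_1=\operatorname{tr}\sqrt{O^\dagger O}$, and let $P(\rho,\sigma)=\sqrt{1-F(\rho,\sigma)^2}$ be the purified distance. Let $\mathcal B^\varepsilon(\rho)=\{\rho'\in S_\le(\mathcal H): P(\rho,\rho')\le\varepsilon\}$. For positive semi-definite $\rho,\sigma$ let $D_{\max}(\rho\|\sigma)=\inf\{\lambda\in\mathbb R: 2^\lambda\sigma\ge\rho\}$, which is $+\infty$ if no such $\lambda$ exists. For $\rho\in S_\le(\mathcal H_{AB})$ with partial traces $\rho_A=\operatorname{tr}_B\rho$ and $\rho_B=\operatorname{tr}_A\rho$, define $${}^2I_{\max}(A:B)_\rho=\inf_{\sigma_B\in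 S_=(\mathcal H_B)}D_{\max}(\rho\,\|\,\rho_A\otimes\sigma_B),\qquad {}^2I^{\varepsilon}_{\max}(A:B)_\rho=\inf_{\rho'\in\mathcal B^\varepsilon(\rho)}{}^2I_{\max}(A:B)_{\rho'},$$ and let ${}^2I^{\varepsilon}_{\max}(B:A)_\rho$ be the same quantity with the roles of $A$ and $B$ interchanged (that is, with $D_{\max}(\rho'\,\|\,\sigma_A\otimes\rho'_B)$ and $\sigma_A\in S_=(\mathcal H_A)$). Finally let $$f(\varepsilon,\varepsilon')=\log\left(\frac1{1-\sqrt{1-\varepsilon^2}}+\frac1{1-\varepsilon'}\right).$$ Then, for every $\rho\in S_=(\mathcal H_{AB})$ and all real $\varepsilon>0$, $\varepsilon'\ge0$ with $2\varepsilon+\varepsilon'<1$, $${}^2I_{\max}^{2\varepsilon+\varepsilon'}(A:B)_\rho\;\le\;{}^2I_{\max}^{\varepsilon+\varepsilon'}(B:A)_\rho+f(\varepsilon,\varepsilon+\varepsilon')\;\le\;{}^2I_{\max}^{\varepsilon'}(A:B)_\rho+f(\varepsilon,\varepsilon+\varepsilon')+f(\varepsilon,\varepsilon').$$ -/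

import Mathlib

open scoped Kronecker ComplexOrder MatrixOrder

noncomputable section

namespace MaxInfo

/-! Operators on a finite-dimensional complex Hilbert space are written as complex matrices in an
orthonormal basis indexed by a finite type; the tensor product of the spaces with index types
`α` and `β` has index type `α × β`. -/

variable {α β : Type*} [Fintype α] [DecidableEq α] [Fintype β] [DecidableEq β]

/-- Normalized density operators: positive semi-definite with trace one. -/
def Normalized (ρ : Matrix α α ℂ) : Prop :=
  ρ.PosSemidef ∧ ρ.trace = 1

/-- Subnormalized density operators: positive semi-definite with `0 < tr ρ ≤ 1`. -/
def Subnormalized (ρ : Matrix α α ℂ) : Prop :=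
  ρ.PosSemidef ∧ 0 < ρ.trace.re ∧ ρ.trace.re ≤ 1

/-- The trace norm `tr √(O† O)`. -/
def traceNorm (O : Matrix α α ℂ) : ℝ :=
  (CFC.sqrt (O.conjTranspose * O)).trace.re

/-- The generalized fidelity `‖√ρ √σ‖₁ + √((1 - tr ρ) (1 - tr σ))`. -/
def fidelity (ρ σ : Matrix α α ℂ) : ℝ :=
  traceNorm (CFC.sqrt ρ * CFC.sqrt σ) +
    Real.sqrt ((1 - ρ.trace.re) * (1 - σ.trace.re))

/-- The purified distance. -/
def purifiedDist (ρ σ : Matrix α α ℂ) : ℝ :=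
  Real.sqrt (1 - fidelity ρ σ ^ 2)

/-- The ball of subnormalized states that are `ε`-close to `ρ` in purified distance. -/
def ball (ε : ℝ) (ρ : Matrix α α ℂ) : Set (Matrix α α ℂ) :=
  {ρ' | Subnormalized ρ' ∧ purifiedDist ρ ρ' ≤ ε}

/-- The partial trace over the second factor, `ρ_A = tr_B ρ_AB`. -/
def trRight (ρ : Matrix (α × β) (α × β) ℂ) : Matrix α α ℂ :=
  Matrix.of fun i i' => ∑ j : β, ρ (i, j) (i', j)

/-- The same operator with the two tensor factors interchanged: `ρ_BA` for `ρ_AB`. -/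
def swap (ρ : Matrix (α × β) (α × β) ℂ) : Matrix (β × α) (β × α) ℂ :=
  ρ.submatrix Prod.swap Prod.swap

/-- The max-relative entropy: the least real `l` with `2 ^ l • σ ≥ ρ` in the Loewner order,
and `+∞` if there is no such `l`. -/
def dmax (ρ σ : Matrix α α ℂ) : EReal :=
  ⨅ (l : ℝ) (_ : ((((2 : ℝ) ^ l : ℝ) : ℂ) • σ - ρ).PosSemidef), (l : EReal)

/-- The max-information `²I_max(A : B)_ρ`, minimizing `D_max(ρ_AB ‖ ρ_A ⊗ σ_B)` over normalized
states `σ_B`. -/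
def maxInfo (ρ : Matrix (α × β) (α × β) ℂ) : EReal :=
  ⨅ (σ : Matrix β β ℂ) (_ : Normalized σ), dmax ρ (trRight ρ ⊗ₖ σ)

/-- The smooth max-information `²I_max^ε(A : B)_ρ`. -/
def smoothMaxInfo (ε : ℝ) (ρ : Matrix (α × β) (α × β) ℂ) : EReal :=
  ⨅ (ρ' : Matrix (α × β) (α × β) ℂ) (_ : ρ' ∈ ball ε ρ), maxInfo ρ'

/-- The correction term `f(ε, ε')`, with the logarithm to base two. -/
def corr (ε ε' : ℝ) : ℝ :=
  Real.logb 2 (1 / (1 - Real.sqrt (1 - ε ^ 2)) + 1 / (1 - ε'))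

end MaxInfo

end

/-! Both inequalities are instances of `smoothMaxInfo_swap_le`, which rests on
`exists_close_le_marginal`. Suppose τ ≤ c σ ⊗ ω with σ arbitrary, and let T be the marginal of τ on
the factor of σ. To trade σ for a marginal, put S = T + δσ and filter τ by G = √T S^(-1/2), the
inverse taken on the support of S. Since G S G† = T, the filter sends σ below T/δ. Adding (T - G T
G†) ⊗ ω' to the filtered state restores the marginal T, and costs only one more copy of T ⊗ ω'. The
filter is gentle: tr(G T) ≥ tr T - δ, by operator monotonicity of the square root and because G is a
contraction. With δ = 1 - √(1 - ε²) this is a rotation by an angle of sine at most ε, so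
`purifiedDist_le_add`, a triangle inequality for angles, adds ε to the smoothing radius. -/

noncomputable section

namespace MaxInfo

open Matrix

/-! ### Polar decomposition, trace norm and contractions -/

section Matrix

variable {n : Type*} [Fintype n] [DecidableEq n]

/-- Two matrices with the same Gram matrix differ by a unitary on the left. -/
theorem exists_unitary_mul_eq {A B : Matrix n n ℂ} (h : Aᴴ * A = Bᴴ * B) :
    ∃ V : Matrix n n ℂ, Vᴴ * V = 1 ∧ V * Vᴴ = 1 ∧ A = V * B := by
  let Φ := Matrix.toEuclideanCLM (n := n) (𝕜 := ℂ)
  have hnorm : ∀ x, ‖Φ A x‖ = ‖Φ B x‖ := by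
    intro x
    have hAB : star (Φ A) * Φ A = star (Φ B) * Φ B := by
      rw [← map_star, ← map_mul, ← map_star, ← map_mul, star_eq_conjTranspose,
        star_eq_conjTranspose, h]
    have key : ∀ T : EuclideanSpace ℂ n →L[ℂ] EuclideanSpace ℂ n,
        ‖T x‖ ^ 2 = RCLike.re (inner ℂ x ((star T * T) x)) := by
      intro T
      exact ContinuousLinearMap.apply_norm_sq_eq_inner_adjoint_right T x
    have : ‖Φ A x‖ ^ 2 = ‖Φ B x‖ ^ 2 := by rw [key, key, hAB]
    exact (sq_eq_sq₀ (norm_nonneg _) (norm_nonneg _)).1 this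
  let b : EuclideanSpace ℂ n →ₗ[ℂ] EuclideanSpace ℂ n := (Φ B).toLinearMap
  obtain ⟨s, hs⟩ := b.rangeRestrict.exists_rightInverse_of_surjective b.range_rangeRestrict
  have hbs : ∀ y, Φ B (s y) = y := fun y => congrArg Subtype.val (LinearMap.congr_fun hs y)
  -- Equal norms make Bx ↦ Ax well defined and isometric on the range of B; in finite dimension it
  -- extends to a unitary.
  let L : b.range →ₗᵢ[ℂ] EuclideanSpace ℂ n :=
    { toLinearMap := (Φ A).toLinearMap ∘ₗ s
      norm_map' := fun y => by
        change ‖Φ A (s y)‖ = ‖y‖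
        rw [hnorm, hbs]; rfl }
  have hL : ∀ x, L.extend (Φ B x) = Φ A x := by
    intro x
    have h1 := L.extend_apply ⟨Φ B x, ⟨x, rfl⟩⟩
    refine h1.trans ?_
    change Φ A (s ⟨Φ B x, _⟩) = Φ A x
    have h2 : ‖Φ A (s ⟨Φ B x, ⟨x, rfl⟩⟩ - x)‖ = 0 := by
      rw [hnorm, map_sub, hbs]; simp
    rw [norm_eq_zero, map_sub, sub_eq_zero] at h2
    exact h2
  let W := L.extend.toContinuousLinearMap
  have hW : star W * W = 1 :=
    (ContinuousLinearMap.norm_map_iff_adjoint_comp_self W).1 L.extend.norm_map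
  obtain ⟨V, hVW⟩ := EquivLike.surjective Φ W
  have hV : Vᴴ * V = 1 := by
    apply EquivLike.injective Φ
    rw [← star_eq_conjTranspose, map_mul, map_star, hVW, hW, map_one]
  refine ⟨V, hV, mul_eq_one_comm.1 hV, ?_⟩
  apply EquivLike.injective Φ
  rw [map_mul, hVW]
  ext1 x
  exact (hL x).symm

theorem sqrt_mul_sqrt {P : Matrix n n ℂ} (hP : P.PosSemidef) :
    CFC.sqrt P * CFC.sqrt P = P :=
  CFC.sqrt_mul_sqrt_self P hP.nonneg

theorem posSemidef_sqrt (P : Matrix n n ℂ) : (CFC.sqrt P).PosSemidef :=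
  nonneg_iff_posSemidef.1 (CFC.sqrt_nonneg P)

theorem conjTranspose_sqrt (P : Matrix n n ℂ) : (CFC.sqrt P)ᴴ = CFC.sqrt P :=
  (posSemidef_sqrt P).isHermitian.eq

theorem conjTranspose_sqrt_mul_self {P : Matrix n n ℂ} (hP : P.PosSemidef) (K : Matrix n n ℂ) :
    (CFC.sqrt P * K)ᴴ * (CFC.sqrt P * K) = Kᴴ * P * K := by
  rw [conjTranspose_mul, conjTranspose_sqrt, mul_assoc, ← mul_assoc (CFC.sqrt P),
    sqrt_mul_sqrt hP, mul_assoc]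

omit [DecidableEq n] in
theorem conjugate_mono {P Q : Matrix n n ℂ} (h : P ≤ Q) (K : Matrix n n ℂ) :
    K * P * Kᴴ ≤ K * Q * Kᴴ := by
  have := (le_iff.1 h).mul_mul_conjTranspose_same K
  rw [Matrix.mul_sub, Matrix.sub_mul] at this
  exact le_iff.2 this

theorem sqrt_le_sqrt {P Q : Matrix n n ℂ} (h : P ≤ Q) : CFC.sqrt P ≤ CFC.sqrt Q :=
  open scoped Matrix.Norms.L2Operator in CFC.sqrt_le_sqrt P Q h

theorem sqrt_eq_of_mul_self {P Q : Matrix n n ℂ} (hQ : Q.PosSemidef) (h : Q * Q = P) :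
    CFC.sqrt P = Q :=
  CFC.sqrt_unique h hQ.nonneg

omit [DecidableEq n] in
theorem trace_re_nonneg {P : Matrix n n ℂ} (hP : P.PosSemidef) : 0 ≤ P.trace.re :=
  (Complex.nonneg_iff.1 hP.trace_nonneg).1

omit [DecidableEq n] in
theorem trace_re_mono {P Q : Matrix n n ℂ} (h : P ≤ Q) : P.trace.re ≤ Q.trace.re := by
  have := trace_re_nonneg (le_iff.1 h)
  rw [trace_sub, Complex.sub_re] at this
  linarith

theorem trace_mul_re_nonneg {P Q : Matrix n n ℂ} (hP : P.PosSemidef) (hQ : Q.PosSemidef) :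
    0 ≤ (P * Q).trace.re := by
  have h := trace_re_nonneg (hQ.mul_mul_conjTranspose_same (CFC.sqrt P))
  rwa [conjTranspose_sqrt, trace_mul_comm, ← mul_assoc, sqrt_mul_sqrt hP] at h

omit [DecidableEq n] in
theorem trace_conjTranspose_re (M : Matrix n n ℂ) : Mᴴ.trace.re = M.trace.re := by
  rw [trace_conjTranspose]; simp

/-- A contraction does not increase the trace against a positive semi-definite matrix. -/
theorem trace_mul_re_le {P G : Matrix n n ℂ} (hP : P.PosSemidef) (hG : Gᴴ * G ≤ 1) :
    (G * P).trace.re ≤ P.trace.re := by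
  have h1 := trace_mul_re_nonneg hP (le_iff.1 hG)
  have h2 := trace_mul_re_nonneg hP (posSemidef_conjTranspose_mul_self (1 - G))
  have h3 := trace_conjTranspose_re (G * P)
  rw [conjTranspose_mul, hP.isHermitian.eq] at h3
  simp only [mul_sub, sub_mul, mul_one, one_mul, conjTranspose_sub, conjTranspose_one, trace_sub,
    Complex.sub_re] at h1 h2
  rw [trace_mul_comm P G] at h2
  linarith

/-- Every matrix has a unitary `V` that turns its trace into its trace norm. -/
theorem exists_unitary_traceNorm (O : Matrix n n ℂ) :
    ∃ V : Matrix n n ℂ, Vᴴ * V = 1 ∧ V * Vᴴ = 1 ∧ traceNorm O = (O * V).trace.re ∧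
      traceNorm Oᴴ = traceNorm O := by
  have hO := posSemidef_conjTranspose_mul_self O
  obtain ⟨V, hV, hV', h⟩ := exists_unitary_mul_eq (A := O) (B := CFC.sqrt (Oᴴ * O)) (by
    rw [conjTranspose_sqrt, sqrt_mul_sqrt hO])
  set P := CFC.sqrt (Oᴴ * O) with hPdef
  have hP : P.PosSemidef := posSemidef_sqrt _
  refine ⟨Vᴴ, by simpa using hV', by simpa using hV, ?_, ?_⟩
  · rw [traceNorm, ← hPdef, h, trace_mul_comm, ← mul_assoc, hV, one_mul]
  · have : CFC.sqrt (Oᴴᴴ * Oᴴ) = V * P * Vᴴ := by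
      apply sqrt_eq_of_mul_self (hP.mul_mul_conjTranspose_same V)
      calc V * P * Vᴴ * (V * P * Vᴴ) = V * P * (Vᴴ * V) * P * Vᴴ := by simp only [mul_assoc]
        _ = Oᴴᴴ * Oᴴ := by
          have h' : Oᴴ = P * Vᴴ := by rw [h, conjTranspose_mul, hP.isHermitian.eq]
          rw [hV, mul_one, conjTranspose_conjTranspose, h', mul_assoc, ← h]
    rw [traceNorm, traceNorm, this, trace_mul_comm, ← mul_assoc, hV, one_mul]

/-- The fidelity term dominates every overlap with a factor of a smaller matrix. -/
theorem trace_sqrt_mul_le_traceNorm {ρ ω K : Matrix n n ℂ} (hω : ω.PosSemidef)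
    (hK : K * Kᴴ ≤ ω) :
    (CFC.sqrt ρ * K).trace.re ≤ traceNorm (CFC.sqrt ρ * CFC.sqrt ω) := by
  obtain ⟨-, -, -, -, h1⟩ := exists_unitary_traceNorm (CFC.sqrt ρ * CFC.sqrt ω)
  have hO : (CFC.sqrt ρ * CFC.sqrt ω)ᴴᴴ * (CFC.sqrt ρ * CFC.sqrt ω)ᴴ =
      CFC.sqrt ρ * ω * CFC.sqrt ρ := by
    rw [conjTranspose_conjTranspose, conjTranspose_mul, conjTranspose_sqrt, conjTranspose_sqrt,
      mul_assoc, ← mul_assoc (CFC.sqrt ω), sqrt_mul_sqrt hω, ← mul_assoc]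
  obtain ⟨V, hV, hV', h2, h3⟩ := exists_unitary_traceNorm (CFC.sqrt ρ * K)
  have hM : (CFC.sqrt ρ * K)ᴴᴴ * (CFC.sqrt ρ * K)ᴴ = CFC.sqrt ρ * (K * Kᴴ) * CFC.sqrt ρ := by
    rw [conjTranspose_conjTranspose, conjTranspose_mul, conjTranspose_sqrt]
    simp only [mul_assoc]
  have hle : CFC.sqrt ρ * (K * Kᴴ) * CFC.sqrt ρ ≤ CFC.sqrt ρ * ω * CFC.sqrt ρ := by
    have := conjugate_mono hK (CFC.sqrt ρ)
    rwa [conjTranspose_sqrt] at this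
  -- Passing to adjoints places the comparable matrices K K† and ω inside the square roots, where
  -- operator monotonicity applies.
  have h4 : traceNorm (CFC.sqrt ρ * K) ≤ traceNorm (CFC.sqrt ρ * CFC.sqrt ω) := by
    rw [← h3, ← h1, traceNorm, traceNorm, hM, hO]
    exact trace_re_mono (sqrt_le_sqrt hle)
  refine le_trans ?_ h4
  set M := CFC.sqrt ρ * K
  obtain ⟨U, hU, -, h⟩ := exists_unitary_mul_eq (A := M) (B := CFC.sqrt (Mᴴ * M)) (by
    rw [conjTranspose_sqrt, sqrt_mul_sqrt (posSemidef_conjTranspose_mul_self M)])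
  rw [traceNorm]
  nth_rw 1 [h]
  exact trace_mul_re_le (posSemidef_sqrt _) hU.le

/-- A factorization of `√P` through `√Q` by a contraction, for `0 ≤ P ≤ Q`. -/
theorem exists_contraction_mul_sqrt {P Q : Matrix n n ℂ} (hP : P.PosSemidef) (hPQ : P ≤ Q) :
    ∃ G : Matrix n n ℂ, Gᴴ * G ≤ 1 ∧ G * CFC.sqrt Q = CFC.sqrt P := by
  have hQ : Q.PosSemidef := nonneg_iff_posSemidef.1 (hP.nonneg.trans hPQ)
  set R := CFC.sqrt Q with hR
  have hRsa : IsSelfAdjoint R := (posSemidef_sqrt Q).isHermitian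
  have hc : ∀ f : ℝ → ℝ, ContinuousOn f (spectrum ℝ R) := fun f =>
    (Matrix.finite_real_spectrum (A := R)).continuousOn f
  -- As 0⁻¹ = 0, this is the pseudo-inverse of √Q, and E = T R below is the projection onto the
  -- support of Q.
  set T : Matrix n n ℂ := cfc (fun x : ℝ => x⁻¹) R with hT
  have hTsa : Tᴴ = T := (cfc_predicate (fun x : ℝ => x⁻¹) R : IsSelfAdjoint T)
  have hcomm : T * R = R * T := (cfc_commute_cfc (fun x : ℝ => x⁻¹) id R).eq |> fun h => by
    simpa only [cfc_id ℝ R] using h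
  have hRTR : R * T * R = R := by
    conv_lhs => rw [← cfc_id ℝ R]
    rw [hT]
    conv_lhs => rw [cfc_id ℝ R]
    conv_lhs =>
      enter [1, 1]; rw [← cfc_id ℝ R]
    conv_lhs =>
      enter [2]; rw [← cfc_id ℝ R]
    rw [← cfc_mul _ _ R (hc _) (hc _), ← cfc_mul _ _ R (hc _) (hc _)]
    conv_rhs => rw [← cfc_id ℝ R]
    refine cfc_congr fun x _ => ?_
    simp
  have hRh : Rᴴ = R := hRsa
  set E := T * R with hE
  have hEh : Eᴴ = E := by rw [hE, conjTranspose_mul, hTsa, hRh, ← hcomm]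
  have hER : R * (1 - E) = 0 := by rw [mul_sub, mul_one, hE, ← mul_assoc, hRTR, sub_self]
  have hEE : E * E = E := by
    rw [hE, mul_assoc, ← mul_assoc R, hRTR]
  have h0 : (CFC.sqrt P * (1 - E))ᴴ * (CFC.sqrt P * (1 - E)) = 0 := by
    have e2 : (1 - E)ᴴ * Q * (1 - E) = 0 := by
      rw [← sqrt_mul_sqrt hQ, ← hR, mul_assoc, mul_assoc, hER, mul_zero, mul_zero]
    apply le_antisymm
    · rw [conjTranspose_sqrt_mul_self hP, ← e2]
      simpa using conjugate_mono hPQ (1 - E)ᴴ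
    · exact (posSemidef_conjTranspose_mul_self _).nonneg
  have hPE : CFC.sqrt P * E = CFC.sqrt P := by
    have := conjTranspose_mul_self_eq_zero.1 h0
    rw [mul_sub, mul_one, sub_eq_zero] at this
    exact this.symm
  refine ⟨CFC.sqrt P * T, ?_, by rw [mul_assoc, hPE]⟩
  have e2 : Tᴴ * Q * T = E := by
    rw [hTsa, ← sqrt_mul_sqrt hQ, ← hR, ← mul_assoc, mul_assoc, ← hcomm, ← hE, hEE]
  have h1 : Tᴴ * P * T ≤ E := by
    rw [← e2]
    simpa using conjugate_mono hPQ Tᴴ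
  rw [conjTranspose_sqrt_mul_self hP]
  refine h1.trans (le_iff.2 ?_)
  have := posSemidef_conjTranspose_mul_self (1 - E)
  have e3 : (1 - E)ᴴ * (1 - E) = 1 - E := by
    rw [conjTranspose_sub, conjTranspose_one, hEh, mul_sub, mul_one, sub_mul, one_mul, hEE]
    simp
  rwa [e3] at this

end Matrix

/-! ### Purified distance and angles -/

section Distance

variable {n m : Type*} [Fintype n] [DecidableEq n] [Fintype m] [DecidableEq m]

/-- The triangle inequality for sines of angles, extracted from the Gram matrix of three vectors:
a unit vector and two vectors of squared length `t ≤ 1`. -/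
theorem sqrt_one_sub_sq_le_add {f g x t e e' : ℝ}
    (gram : ∀ p q r : ℝ, 0 ≤ p ^ 2 + q ^ 2 * t + r ^ 2 * t + 2 * p * q * f + 2 * q * r * g +
      2 * p * r * x)
    (ht : t ≤ 1) (hf : 0 ≤ f) (he' : Real.sqrt (1 - f ^ 2) ≤ e') (he : 0 < e)
    (hg : Real.sqrt (1 - e ^ 2) ≤ g + (1 - t)) (hsum : e + e' < 1) :
    0 ≤ x ∧ Real.sqrt (1 - x ^ 2) ≤ e + e' := by
  set h := g + (1 - t) with hh
  -- A common extra coordinate √(1 - t) turns the two short vectors into unit vectors with inner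
  -- product h; f and x do not change.
  have gram' : ∀ p q r : ℝ, 0 ≤ p ^ 2 + q ^ 2 + r ^ 2 + 2 * p * q * f + 2 * q * r * h +
      2 * p * r * x := by
    intro p q r
    have h1 := gram p q r
    have h2 := mul_nonneg (sq_nonneg (q + r)) (sub_nonneg.2 ht)
    calc (0 : ℝ) ≤ _ := add_nonneg h1 h2
      _ = _ := by rw [hh]; ring
  have he'0 : 0 ≤ e' := (Real.sqrt_nonneg _).trans he'
  have hf1 : f ≤ 1 := by linarith [gram' 1 (-1) 0]
  have hh1 : h ≤ 1 := by linarith [gram' 0 1 (-1)]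
  have hh0 : 0 ≤ h := (Real.sqrt_nonneg _).trans hg
  have hs1 : Real.sqrt (1 - f ^ 2) ^ 2 = 1 - f ^ 2 := Real.sq_sqrt (by nlinarith)
  have hs2 : Real.sqrt (1 - h ^ 2) ^ 2 = 1 - h ^ 2 := Real.sq_sqrt (by nlinarith)
  have hs2e : Real.sqrt (1 - h ^ 2) ≤ e := by
    rw [Real.sqrt_le_left he.le]
    have := (Real.sqrt_le_left hh0).1 hg
    linarith
  have h10 := Real.sqrt_nonneg (1 - f ^ 2)
  have h20 := Real.sqrt_nonneg (1 - h ^ 2)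
  set s₁ := Real.sqrt (1 - f ^ 2)
  set s₂ := Real.sqrt (1 - h ^ 2)
  -- Cauchy–Schwarz for the components of the outer vectors orthogonal to the middle one; the chosen
  -- q removes the projection onto it.
  have hy : (x - f * h) ^ 2 ≤ (s₁ * s₂) ^ 2 := by
    have hd := discrim_le_zero (a := s₁ ^ 2) (b := 2 * (x - f * h)) (c := s₂ ^ 2) (fun p => by
      have := gram' p (-(p * f + h)) 1
      rw [hs1, hs2]
      linarith)
    rw [discrim] at hd
    linarith
  have hx : f * h - s₁ * s₂ ≤ x := by
    have := (abs_le_of_sq_le_sq' hy (by positivity)).1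
    linarith
  have hle : s₁ + s₂ ≤ e + e' := by linarith
  have hs12 := mul_nonneg h10 h20
  -- The cosine of the summed angles: s₁ + s₂ < 1 keeps the sum below a right angle.
  have hc : 0 ≤ f * h - s₁ * s₂ := by
    have h1 : s₂ ≤ f := by nlinarith
    have h2 : s₁ ≤ h := by nlinarith
    linarith [mul_le_mul h1 h2 h10 hf]
  refine ⟨hc.trans hx, ?_⟩
  rw [Real.sqrt_le_left (by linarith)]
  have h1 : (f * h - s₁ * s₂) ^ 2 ≤ x ^ 2 := pow_le_pow_left₀ hc hx 2
  have h2 : (f * h - s₁ * s₂) ^ 2 + (s₁ * h + s₂ * f) ^ 2 = 1 := by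
    calc _ = (f ^ 2 + s₁ ^ 2) * (h ^ 2 + s₂ ^ 2) := by ring
      _ = 1 := by rw [hs1, hs2]; ring
  have h3 : (s₁ * h + s₂ * f) ^ 2 ≤ (e + e') ^ 2 := by
    apply pow_le_pow_left₀ (by positivity)
    linarith [mul_le_mul_of_nonneg_left hh1 h10, mul_le_mul_of_nonneg_left hf1 h20]
  linarith

theorem traceNorm_nonneg (O : Matrix n n ℂ) : 0 ≤ traceNorm O :=
  trace_re_nonneg (posSemidef_sqrt _)

theorem fidelity_of_normalized {ρ : Matrix n n ℂ} (hρ : Normalized ρ) (τ : Matrix n n ℂ) :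
    fidelity ρ τ = traceNorm (CFC.sqrt ρ * CFC.sqrt τ) := by
  simp [fidelity, hρ.2]

/-- The squared Frobenius norm of a real combination of three matrices. -/
theorem gram_nonneg (a b c : Matrix n n ℂ) (p q r : ℝ) :
    0 ≤ p ^ 2 * (aᴴ * a).trace.re + q ^ 2 * (bᴴ * b).trace.re + r ^ 2 * (cᴴ * c).trace.re +
      2 * p * q * (aᴴ * b).trace.re + 2 * q * r * (bᴴ * c).trace.re +
      2 * p * r * (aᴴ * c).trace.re := by
  have h := trace_re_nonneg (posSemidef_conjTranspose_mul_self
    ((p : ℂ) • a + (q : ℂ) • b + (r : ℂ) • c))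
  have h1 : (bᴴ * a).trace.re = (aᴴ * b).trace.re := by
    rw [← trace_conjTranspose_re, conjTranspose_mul, conjTranspose_conjTranspose]
  have h2 : (cᴴ * a).trace.re = (aᴴ * c).trace.re := by
    rw [← trace_conjTranspose_re, conjTranspose_mul, conjTranspose_conjTranspose]
  have h3 : (cᴴ * b).trace.re = (bᴴ * c).trace.re := by
    rw [← trace_conjTranspose_re, conjTranspose_mul, conjTranspose_conjTranspose]
  simp only [conjTranspose_add, conjTranspose_smul, Complex.star_def, Complex.conj_ofReal,
    add_mul, mul_add, smul_mul_assoc, mul_smul_comm, trace_add, trace_smul, smul_eq_mul,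
    Complex.add_re, Complex.re_ofReal_mul, h1, h2, h3] at h
  linarith

/-- If `τ'` dominates `G τ G†` for a map `G` that moves `τ` little, then `τ'` is close to
everything that `τ` is close to. -/
theorem purifiedDist_le_add {ρ τ τ' G : Matrix n n ℂ} {e e' : ℝ} (hρ : Normalized ρ)
    (hτ : τ.PosSemidef) (hτ1 : τ.trace.re ≤ 1) (hτ' : τ'.PosSemidef)
    (hG : (Gᴴ * G * τ).trace.re ≤ τ.trace.re) (hle : G * τ * Gᴴ ≤ τ')
    (hclose : τ.trace.re - (1 - Real.sqrt (1 - e ^ 2)) ≤ (G * τ).trace.re)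
    (hdist : purifiedDist ρ τ ≤ e') (he : 0 < e) (hsum : e + e' < 1) :
    purifiedDist ρ τ' ≤ e + e' := by
  obtain ⟨V, hV, hV', htr, -⟩ := exists_unitary_traceNorm (CFC.sqrt ρ * CFC.sqrt τ)
  rw [purifiedDist, fidelity_of_normalized hρ] at hdist
  rw [purifiedDist, fidelity_of_normalized hρ]
  -- V makes the first overlap equal to the fidelity of ρ and τ; the overlap of the outer two only
  -- bounds that of ρ and τ' from below, which suffices.
  have key := gram_nonneg (CFC.sqrt ρ) (CFC.sqrt τ * V) (G * CFC.sqrt τ * V)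
  have haa : ((CFC.sqrt ρ)ᴴ * CFC.sqrt ρ).trace.re = 1 := by
    rw [conjTranspose_sqrt, sqrt_mul_sqrt hρ.1, hρ.2, Complex.one_re]
  have hbb : ((CFC.sqrt τ * V)ᴴ * (CFC.sqrt τ * V)).trace.re = τ.trace.re := by
    rw [conjTranspose_sqrt_mul_self hτ, mul_assoc, trace_mul_comm, mul_assoc, hV', mul_one]
  have hab : ((CFC.sqrt ρ)ᴴ * (CFC.sqrt τ * V)).trace.re =
      traceNorm (CFC.sqrt ρ * CFC.sqrt τ) := by
    rw [htr, conjTranspose_sqrt, mul_assoc]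
  have hsand : ∀ M : Matrix n n ℂ,
      ((CFC.sqrt τ * V)ᴴ * (M * CFC.sqrt τ * V)).trace = (M * τ).trace := by
    intro M
    rw [conjTranspose_mul, conjTranspose_sqrt, trace_mul_comm]
    calc _ = (M * CFC.sqrt τ * (V * Vᴴ) * CFC.sqrt τ).trace := by simp only [mul_assoc]
      _ = _ := by rw [hV', mul_one, mul_assoc, sqrt_mul_sqrt hτ]
  have hbc := hsand G
  have hcc : (G * CFC.sqrt τ * V)ᴴ * (G * CFC.sqrt τ * V) =
      (CFC.sqrt τ * V)ᴴ * (Gᴴ * G * CFC.sqrt τ * V) := by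
    simp only [conjTranspose_mul, mul_assoc]
  have hcc' := hsand (Gᴴ * G)
  rw [← hcc] at hcc'
  have hx : ((CFC.sqrt ρ)ᴴ * (G * CFC.sqrt τ * V)).trace.re ≤
      traceNorm (CFC.sqrt ρ * CFC.sqrt τ') := by
    rw [conjTranspose_sqrt]
    refine trace_sqrt_mul_le_traceNorm hτ' (le_trans (le_of_eq ?_) hle)
    calc _ = G * CFC.sqrt τ * (V * Vᴴ) * CFC.sqrt τ * Gᴴ := by
          simp only [conjTranspose_mul, conjTranspose_sqrt, mul_assoc]
      _ = _ := by rw [hV', mul_one, mul_assoc G, sqrt_mul_sqrt hτ]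
  obtain ⟨h0, h1⟩ := sqrt_one_sub_sq_le_add
    (x := ((CFC.sqrt ρ)ᴴ * (G * CFC.sqrt τ * V)).trace.re) (fun p q r => by
      have h := key p q r
      rw [haa, hbb, hab, hbc, hcc', mul_one] at h
      exact h.trans (by gcongr)) hτ1 (traceNorm_nonneg _) hdist he
    (by linarith) hsum
  refine le_trans (Real.sqrt_le_sqrt ?_) h1
  linarith [pow_le_pow_left₀ h0 hx 2]

theorem sqrt_submatrix {P : Matrix n n ℂ} (hP : P.PosSemidef) (e : m ≃ n) :
    CFC.sqrt (P.submatrix e e) = (CFC.sqrt P).submatrix e e :=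
  sqrt_eq_of_mul_self ((posSemidef_sqrt P).submatrix e) (by
    rw [submatrix_mul_equiv, sqrt_mul_sqrt hP])

omit [DecidableEq n] [DecidableEq m] in
theorem trace_submatrix (P : Matrix n n ℂ) (e : m ≃ n) :
    (P.submatrix e e).trace = P.trace :=
  e.sum_comp fun i => P i i

theorem traceNorm_submatrix (O : Matrix n n ℂ) (e : m ≃ n) :
    traceNorm (O.submatrix e e) = traceNorm O := by
  rw [traceNorm, traceNorm, conjTranspose_submatrix, submatrix_mul_equiv,
    sqrt_submatrix (posSemidef_conjTranspose_mul_self O), trace_submatrix]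

theorem purifiedDist_submatrix {P Q : Matrix n n ℂ} (hP : P.PosSemidef) (hQ : Q.PosSemidef)
    (e : m ≃ n) : purifiedDist (P.submatrix e e) (Q.submatrix e e) = purifiedDist P Q := by
  rw [purifiedDist, purifiedDist, fidelity, fidelity, sqrt_submatrix hP, sqrt_submatrix hQ,
    submatrix_mul_equiv, traceNorm_submatrix, trace_submatrix, trace_submatrix]

end Distance

/-! ### Partial traces, the filtered state and exchange of the factors -/

section Bipartite

variable {α β : Type*} [Fintype α] [Fintype β]

theorem trace_trRight (τ : Matrix (α × β) (α × β) ℂ) : (trRight τ).trace = τ.trace := by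
  simp [trRight, Matrix.trace, Fintype.sum_prod_type]

omit [Fintype α] in
theorem trRight_add (σ τ : Matrix (α × β) (α × β) ℂ) :
    trRight (σ + τ) = trRight σ + trRight τ := by
  ext i j
  simp [trRight, Finset.sum_add_distrib]

omit [Fintype α] in
theorem trRight_kronecker (P : Matrix α α ℂ) (Q : Matrix β β ℂ) :
    trRight (P ⊗ₖ Q) = Q.trace • P := by
  ext i j
  simp [trRight, Matrix.trace, ← Finset.mul_sum, mul_comm]

theorem trRight_kronecker_one_mul [DecidableEq β] (K : Matrix α α ℂ)
    (τ : Matrix (α × β) (α × β) ℂ) : trRight ((K ⊗ₖ (1 : Matrix β β ℂ)) * τ) = K * trRight τ := by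
  ext i j
  simp only [trRight, of_apply, mul_apply, Fintype.sum_prod_type, kroneckerMap_apply, one_apply,
    mul_ite, mul_one, mul_zero, ite_mul, zero_mul, Finset.sum_ite_eq, Finset.mem_univ, if_true,
    Finset.mul_sum]
  exact Finset.sum_comm

theorem trRight_mul_kronecker_one [DecidableEq β] (K : Matrix α α ℂ)
    (τ : Matrix (α × β) (α × β) ℂ) : trRight (τ * (K ⊗ₖ (1 : Matrix β β ℂ))) = trRight τ * K := by
  ext i j
  simp only [trRight, of_apply, mul_apply, Fintype.sum_prod_type, kroneckerMap_apply, one_apply,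
    mul_ite, mul_one, mul_zero, Finset.sum_ite_eq', Finset.mem_univ, if_true,
    Finset.sum_mul]
  exact Finset.sum_comm

omit [Fintype α] in
theorem posSemidef_trRight {τ : Matrix (α × β) (α × β) ℂ} (hτ : τ.PosSemidef) :
    (trRight τ).PosSemidef := by
  have : trRight τ = ∑ j : β, τ.submatrix (fun i => (i, j)) (fun i => (i, j)) := by
    ext i i'
    simp [trRight, Matrix.sum_apply]
  rw [this]
  exact posSemidef_sum _ fun j _ => hτ.submatrix _

theorem kronecker_mono_left {P Q : Matrix α α ℂ} (h : P ≤ Q) {R : Matrix β β ℂ}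
    (hR : R.PosSemidef) : P ⊗ₖ R ≤ Q ⊗ₖ R := by
  have h1 := (le_iff.1 h).kronecker hR
  refine le_iff.2 ?_
  have : Q ⊗ₖ R - P ⊗ₖ R = (Q - P) ⊗ₖ R := by
    ext ⟨i, j⟩ ⟨i', j'⟩; simp [sub_mul]
  rwa [this]

theorem kronecker_mono_right {P Q : Matrix β β ℂ} (h : P ≤ Q) {R : Matrix α α ℂ}
    (hR : R.PosSemidef) : R ⊗ₖ P ≤ R ⊗ₖ Q := by
  have h1 := hR.kronecker (le_iff.1 h)
  refine le_iff.2 ?_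
  have : R ⊗ₖ Q - R ⊗ₖ P = R ⊗ₖ (Q - P) := by
    ext ⟨i, j⟩ ⟨i', j'⟩; simp [mul_sub]
  rwa [this]

omit [Fintype α] in
theorem smul_mono {P Q : Matrix α α ℂ} (h : P ≤ Q) {c : ℝ} (hc : 0 ≤ c) :
    (c : ℂ) • P ≤ (c : ℂ) • Q := by
  have h1 := (le_iff.1 h).smul (Complex.zero_le_real.2 hc)
  rw [smul_sub] at h1
  exact le_iff.2 h1

omit [Fintype α] in
theorem smul_mono_left {P : Matrix α α ℂ} (hP : P.PosSemidef) {c d : ℝ} (h : c ≤ d) :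
    (c : ℂ) • P ≤ (d : ℂ) • P := by
  have h1 := hP.smul (Complex.zero_le_real.2 (sub_nonneg.2 h))
  rw [Complex.ofReal_sub, sub_smul] at h1
  exact le_iff.2 h1

theorem trace_eq_ofReal {P : Matrix α α ℂ} (hP : P.PosSemidef) : P.trace = (P.trace.re : ℂ) :=
  Complex.ext rfl (by simpa using (Complex.nonneg_iff.1 hP.trace_nonneg).2.symm)

variable [DecidableEq α] [DecidableEq β]

/-- A state dominated by a product operator is close to one that is dominated by the product of
its own marginal with a normalized state. -/
theorem exists_close_le_marginal {ρ τ : Matrix (α × β) (α × β) ℂ} {σ : Matrix α α ℂ}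
    {ω : Matrix β β ℂ} {ε ε' c : ℝ} (hρ : Normalized ρ) (hτ : Subnormalized τ)
    (hdist : purifiedDist ρ τ ≤ ε') (hσ : Normalized σ) (hω : Subnormalized ω)
    (hc : 0 ≤ c) (hle : τ ≤ (c : ℂ) • (σ ⊗ₖ ω)) (hε : 0 < ε) (hsum : ε + ε' < 1) :
    ∃ τ' : Matrix (α × β) (α × β) ℂ, Subnormalized τ' ∧ purifiedDist ρ τ' ≤ ε + ε' ∧
      ∃ ω' : Matrix β β ℂ, Normalized ω' ∧
        τ' ≤ ((c * (1 / (1 - Real.sqrt (1 - ε ^ 2))) + 1 : ℝ) : ℂ) • (trRight τ' ⊗ₖ ω') := by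
  set δ := 1 - Real.sqrt (1 - ε ^ 2) with hδ
  have hδ0 : 0 < δ := by
    have : Real.sqrt (1 - ε ^ 2) < 1 := by
      rw [Real.sqrt_lt' one_pos]; nlinarith
    linarith
  obtain ⟨hσp, hσt⟩ := hσ
  obtain ⟨hωp, hω0, hω1⟩ := hω
  obtain ⟨hτp, hτ0, hτ1⟩ := hτ
  have hτX := posSemidef_trRight hτp
  set T := trRight τ with hT
  have hD : ((δ : ℂ) • σ).PosSemidef := hσp.smul (Complex.zero_le_real.2 hδ0.le)
  have hTS : T ≤ T + (δ : ℂ) • σ := le_iff.2 (by simpa using hD)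
  have hS : (T + (δ : ℂ) • σ).PosSemidef := hτX.add hD
  obtain ⟨G, hG1, hGS⟩ := exists_contraction_mul_sqrt hτX hTS
  set S := T + (δ : ℂ) • σ with hSdef
  have hGSG : G * S * Gᴴ = T := by
    calc G * S * Gᴴ = (G * CFC.sqrt S) * (G * CFC.sqrt S)ᴴ := by
          rw [conjTranspose_mul, conjTranspose_sqrt]
          nth_rw 1 [← sqrt_mul_sqrt hS]
          simp only [mul_assoc]
      _ = T := by rw [hGS, conjTranspose_sqrt, sqrt_mul_sqrt hτX]
  have hGTG : G * T * Gᴴ ≤ T := (conjugate_mono hTS G).trans hGSG.le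
  have hGσG : G * σ * Gᴴ ≤ ((1 / δ : ℝ) : ℂ) • T := by
    have h1 : (δ : ℂ) • σ ≤ S := le_iff.2 (by simpa [hSdef] using hτX)
    have h2 := smul_mono ((conjugate_mono h1 G).trans hGSG.le) (one_div_pos.2 hδ0).le
    refine le_trans (le_of_eq ?_) h2
    have hδc : (δ : ℂ) ≠ 0 := by exact_mod_cast hδ0.ne'
    rw [mul_smul_comm, smul_mul_assoc, smul_smul]
    push_cast
    rw [one_div_mul_cancel hδc, one_smul]
  have hclose : T.trace.re - δ ≤ (G * T).trace.re := by
    -- Here G S = √T √S, and √S ≥ √T.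
    have h1 : T.trace.re ≤ (G * S).trace.re := by
      have e1 : G * S = CFC.sqrt T * CFC.sqrt S := by
        rw [← hGS, mul_assoc, sqrt_mul_sqrt hS]
      have h2 := trace_mul_re_nonneg (posSemidef_sqrt T) (le_iff.1 (sqrt_le_sqrt hTS))
      rw [mul_sub, sqrt_mul_sqrt hτX, trace_sub, Complex.sub_re] at h2
      rw [e1]; linarith
    have h3 := trace_mul_re_le hD hG1
    have h4 : ((δ : ℂ) • σ).trace.re = δ := by simp [hσt]
    rw [hSdef, mul_add, trace_add, Complex.add_re] at h1
    linarith
  have hwt : ω.trace = (ω.trace.re : ℂ) := trace_eq_ofReal hωp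
  set w := ω.trace.re
  set ω' : Matrix β β ℂ := ((w⁻¹ : ℝ) : ℂ) • ω with hω'
  have hω'p : ω'.PosSemidef := hωp.smul (Complex.zero_le_real.2 (inv_nonneg.2 hω0.le))
  have hω't : ω'.trace = 1 := by
    rw [hω', trace_smul, hwt, smul_eq_mul, ← Complex.ofReal_mul, inv_mul_cancel₀ hω0.ne',
      Complex.ofReal_one]
  have hωω' : ω ≤ ω' := by
    have := smul_mono_left hωp (one_le_inv_iff₀.2 ⟨hω0, hω1⟩)
    rwa [Complex.ofReal_one, one_smul] at this
  set K : Matrix (α × β) (α × β) ℂ := G ⊗ₖ (1 : Matrix β β ℂ) with hK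
  have hKh : Kᴴ = Gᴴ ⊗ₖ (1 : Matrix β β ℂ) := by
    rw [hK, conjTranspose_kronecker, conjTranspose_one]
  have hdiff : (T - G * T * Gᴴ).PosSemidef := le_iff.1 hGTG
  have hprod : ((T - G * T * Gᴴ) ⊗ₖ ω').PosSemidef := hdiff.kronecker hω'p
  have hKτ : (K * τ * Kᴴ).PosSemidef := hτp.mul_mul_conjTranspose_same K
  set τ' := K * τ * Kᴴ + (T - G * T * Gᴴ) ⊗ₖ ω' with hτ'
  have hτ'p : τ'.PosSemidef := hKτ.add hprod
  have hmarg : trRight τ' = T := by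
    rw [hτ', trRight_add, trRight_kronecker, hω't, one_smul, hKh, trRight_mul_kronecker_one,
      trRight_kronecker_one_mul, add_sub_cancel]
  have htrace : τ'.trace = τ.trace := by
    rw [← trace_trRight, hmarg, hT, trace_trRight]
  have hTtr : T.trace = τ.trace := trace_trRight τ
  refine ⟨τ', ⟨hτ'p, by rwa [htrace], by rwa [htrace]⟩, ?_, ω', ⟨hω'p, hω't⟩, ?_⟩
  · refine purifiedDist_le_add (G := K) hρ hτp hτ1 hτ'p ?_ ?_ ?_ hdist hε hsum
    · have h1 := trace_mul_re_nonneg hτX (le_iff.1 hG1)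
      rw [mul_sub, mul_one, trace_sub, Complex.sub_re, trace_mul_comm, hTtr] at h1
      have h2 : (Kᴴ * K * τ).trace = (Gᴴ * G * T).trace := by
        rw [← trace_trRight, hKh, hK, mul_assoc, trRight_kronecker_one_mul,
          trRight_kronecker_one_mul, mul_assoc]
      rw [h2]; linarith
    · exact le_iff.2 (by simpa [hτ'] using hprod)
    · rw [← hTtr, ← trace_trRight (K * τ), hK, trRight_kronecker_one_mul]
      exact hclose
  · rw [hmarg, Complex.ofReal_add, add_smul, Complex.ofReal_one, one_smul, hτ']
    refine add_le_add ?_ ?_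
    · calc K * τ * Kᴴ ≤ K * ((c : ℂ) • (σ ⊗ₖ ω)) * Kᴴ := conjugate_mono hle K
        _ = (c : ℂ) • ((G * σ * Gᴴ) ⊗ₖ ω) := by
          rw [mul_smul_comm, smul_mul_assoc, hKh, hK, ← mul_kronecker_mul, ← mul_kronecker_mul,
            one_mul, mul_one]
        _ ≤ (c : ℂ) • ((((1 / δ : ℝ) : ℂ) • T) ⊗ₖ ω) :=
          smul_mono (kronecker_mono_left hGσG hωp) hc
        _ = ((c * (1 / δ) : ℝ) : ℂ) • (T ⊗ₖ ω) := by
          rw [smul_kronecker, smul_smul, ← Complex.ofReal_mul]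
        _ ≤ _ := smul_mono (kronecker_mono_right hωω' hτX) (by positivity)
    · refine kronecker_mono_left (le_iff.2 ?_) hω'p
      simpa using hτX.mul_mul_conjTranspose_same G

omit [Fintype α] [Fintype β] [DecidableEq α] [DecidableEq β] in
theorem swap_kronecker (P : Matrix α α ℂ) (Q : Matrix β β ℂ) : swap (P ⊗ₖ Q) = Q ⊗ₖ P := by
  ext ⟨i, j⟩ ⟨i', j'⟩
  simp [swap, mul_comm]

omit [DecidableEq α] [DecidableEq β] in
theorem normalized_swap {ρ : Matrix (α × β) (α × β) ℂ} (hρ : Normalized ρ) :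
    Normalized (swap ρ) :=
  ⟨hρ.1.submatrix _, (trace_submatrix ρ (Equiv.prodComm β α)).trans hρ.2⟩

omit [DecidableEq α] [DecidableEq β] in
theorem subnormalized_swap {ρ : Matrix (α × β) (α × β) ℂ} (hρ : Subnormalized ρ) :
    Subnormalized (swap ρ) := by
  have h : (swap ρ).trace = ρ.trace := trace_submatrix ρ (Equiv.prodComm β α)
  exact ⟨hρ.1.submatrix _, h ▸ hρ.2.1, h ▸ hρ.2.2⟩

/-- The smooth max-information changes little when the two factors are interchanged. -/
theorem smoothMaxInfo_swap_le {ρ : Matrix (α × β) (α × β) ℂ} (hρ : Normalized ρ) {ε ε' : ℝ}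
    (hε : 0 < ε) (hε' : 0 ≤ ε') (hsum : ε + ε' < 1) :
    smoothMaxInfo (ε + ε') (swap ρ) ≤ smoothMaxInfo ε' ρ + (corr ε ε' : EReal) := by
  -- With the finite correction moved left, the infima can be tested on arbitrary candidates; no
  -- minimizer is needed.
  rw [← EReal.sub_le_iff_le_add (.inl (EReal.coe_ne_bot _)) (.inl (EReal.coe_ne_top _))]
  refine le_iInf₂ fun τ hτ => le_iInf₂ fun σ hσ => le_iInf₂ fun l hl => ?_
  rw [EReal.sub_le_iff_le_add (.inl (EReal.coe_ne_bot _)) (.inl (EReal.coe_ne_top _)),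
    ← EReal.coe_add]
  obtain ⟨hτs, hdist⟩ := hτ
  have hA : Subnormalized (trRight τ) :=
    ⟨posSemidef_trRight hτs.1, by rw [trace_trRight]; exact hτs.2.1,
      by rw [trace_trRight]; exact hτs.2.2⟩
  have hle : swap τ ≤ (((2 : ℝ) ^ l : ℝ) : ℂ) • (σ ⊗ₖ trRight τ) := by
    rw [← swap_kronecker]
    exact le_iff.2 (hl.submatrix Prod.swap)
  -- Taking traces gives tr τ ≤ 2^l tr τ. This lets the additive 1 be absorbed into 2^l / (1 - ε').
  have hone : (1 : ℝ) ≤ (2 : ℝ) ^ l := by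
    have h1 := trace_re_mono (le_iff.2 hl)
    rw [trace_smul, trace_kronecker, hσ.2, mul_one, smul_eq_mul, Complex.re_ofReal_mul,
      trace_trRight] at h1
    by_contra! h
    linarith [mul_lt_mul_of_pos_right h hτs.2.1]
  obtain ⟨τ', hτ', hdist', ω', hω', hle'⟩ := exists_close_le_marginal (normalized_swap hρ)
    (subnormalized_swap hτs)
    ((purifiedDist_submatrix hρ.1 hτs.1 (Equiv.prodComm β α)).trans_le hdist) hσ hA
    (by positivity) hle hε hsum
  refine (iInf₂_le τ' ⟨hτ', hdist'⟩).trans ((iInf₂_le ω' hω').trans (iInf₂_le (l + corr ε ε') ?_))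
  refine le_iff.1 (hle'.trans (smul_mono_left
    ((posSemidef_trRight hτ'.1).kronecker hω'.1) ?_))
  have hδ0 : 0 < 1 - Real.sqrt (1 - ε ^ 2) := by
    have : Real.sqrt (1 - ε ^ 2) < 1 := by
      rw [Real.sqrt_lt' one_pos]; nlinarith
    linarith
  have h1' : 0 < 1 - ε' := by linarith
  rw [Real.rpow_add two_pos, corr, Real.rpow_logb two_pos (by norm_num) (by positivity), mul_add]
  have h1 : 1 ≤ 1 / (1 - ε') := by rw [le_div_iff₀ h1']; linarith
  linarith [one_le_mul_of_one_le_of_one_le hone h1]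

end Bipartite

end MaxInfo

end

theorem mainTheorem4 {A B : Type*} [Fintype A] [DecidableEq A] [Fintype B] [DecidableEq B]
    (ρ : Matrix (A × B) (A × B) ℂ) (hρ : MaxInfo.Normalized ρ)
    (ε ε' : ℝ) (hε : 0 < ε) (hε' : 0 ≤ ε') (hsmall : 2 * ε + ε' < 1) :
    MaxInfo.smoothMaxInfo (2 * ε + ε') ρ ≤
        MaxInfo.smoothMaxInfo (ε + ε') (MaxInfo.swap ρ) + (MaxInfo.corr ε (ε + ε') : EReal) ∧
      MaxInfo.smoothMaxInfo (ε + ε') (MaxInfo.swap ρ) + (MaxInfo.corr ε (ε + ε') : EReal) ≤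
        MaxInfo.smoothMaxInfo ε' ρ + (MaxInfo.corr ε (ε + ε') : EReal) +
          (MaxInfo.corr ε ε' : EReal) := by
  constructor
  · have h := MaxInfo.smoothMaxInfo_swap_le (MaxInfo.normalized_swap hρ) hε
      (add_nonneg hε.le hε') (by linarith)
    have e1 : ε + (ε + ε') = 2 * ε + ε' := by ring
    -- Exchanging the factors twice returns ρ definitionally.
    rwa [e1] at h
  · rw [add_right_comm]
    exact add_le_add_left
      (MaxInfo.smoothMaxInfo_swap_le hρ hε hε' (by linarith)) _
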